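/- Let $\varphi(z)=(e^z-1)/z=\sum_{i\ge0}z^i/(i+1)!$. Consider the following four-stage scheme for autonomous systems $y'=f(y)$ in $\mathbb R^N$. With step size $h$ and $J_n=f'(y_n)$, set $$k_i=\varphi(h\gamma A_n)\Bigl(hF_i+hA_n\sum_{j=1}^{i-1}\gamma_{i,j}k_j\Bigr),\qquad F_i=f\Bigl(y_n+\sum_{j=1}^{i-1}\alpha_{i,j}k_j\Bigr),\qquad y_{n+1}=y_n+\sum_{i=1}^4 b_ik_i .$$ Here $A_n=VV^TJ_nVV^T$, where the columns of $V$ form an orthonormal basis of the Krylov space $\mathcal K_M=\operatorname{span}\{f(y_n),J_nf(y_n),\dots,J_n^{M-1}f(y_n)\}$; thus $VV^T$ is the orthogonal projection onto $\mathcal K_M$. The coefficients of the method expK are $\gamma=\tfrac14$ and $$\alpha_{2,1}=1,\quad \alpha_{3,1}=\tfrac{41}{80},\quad \alpha_{3,2}=-\tfrac1{80},\quad \alpha_{4,1}=\tfrac14,\quad \alpha_{4,2}=\tfrac1{12},\quad \alpha_{4,3}=\tfrac16,$$ $$\gamma_{2,1}=\tfrac78,\quad \gamma_{3,1}=\tfrac1{16},\quad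 \gamma_{3,2}=0,\quad \gamma_{4,1}=-\tfrac1{32},\quad \gamma_{4,2}=\tfrac1{24},\quad \gamma_{4,3}=-\tfrac5{12},$$ $$b_1=\tfrac16,\quad b_2=\tfrac16,\quad b_3=0,\quad b_4=\tfrac23,$$ with $\alpha_{i,j}=\gamma_{i,j}=0$ for $j\ge i$. Put $\beta_{i,j}=\alpha_{i,j}+\gamma_{i,j}$. (i) These coefficients satisfy the nine exponential-$K$ order conditions (all sums over all stage indices that occur): $$\begin{aligned} &\textstyle\sum b_j=1,\qquad \sum b_j\beta_{j,k}=\tfrac12(1-\gamma),\qquad \sum b_j\alpha_{j,k}\alpha_{j,l}=\tfrac13,\\ &\textstyle\sum b_j\beta_{j,k}\beta_{k,l}=\tfrac13(\tfrac12-\gamma)(1-\gamma),\qquad \sum b_j\alpha_{j,k}\alpha_{j,l}\alpha_{j,m}=\tfrac14,\\ &\textstyle\sum b_j\alpha_{j,k}\beta_{k,l}\alpha_{j,m}=\tfrac18-\tfrac\gamma6,\qquad \sum b_j\alpha_{j,k}\alpha_{k,m}\alpha_{k,l}=\tfrac1{12},\\ &\textstyle\sum b_j\gamma_{j,k}\alpha_{k,m}\alpha_{k,l}=-\tfrac\gamma6,\qquad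 \sum b_j\beta_{j,k}\beta_{k,l}\beta_{l,m}=\tfrac14(\tfrac13-\gamma)(\tfrac12-\gamma)(1-\gamma). \end{aligned}$$ (ii) For every $M\ge4$ the method has order four: for every $N$, every $f:\mathbb R^N\to\mathbb R^N$ and every solution $y$ of $y'=f(y)$ on an interval $[t_n,t_F]$, $t_n<t_F$, such that $f$ is of class $C^4$ in a neighbourhood of $y(t_n)$, one step of size $h$ started from $y_n=y(t_n)$ satisfies $\|y_{n+1}-y(t_n+h)\|=O(h^5)$ as $h\to0^+$. -/

import Mathlib

open Set Filter Topology Asymptotics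

noncomputable section

namespace ExpK

/-- The state space `ℝ^N` with its Euclidean inner product. -/
abbrev State (N : ℕ) : Type := EuclideanSpace ℝ (Fin N)

/-- The matrix function `φ(Z) = ∑_{i ≥ 0} Z^i / (i+1)!`, that is, the entire function
`φ(z) = (e^z - 1) / z` (with `φ(0) = 1`) applied to a linear operator on `ℝ^N`. -/
def phi {N : ℕ} (Z : State N →L[ℝ] State N) : State N →L[ℝ] State N :=
  ∑' i : ℕ, ((Nat.factorial (i + 1) : ℝ)⁻¹) • Z ^ i

theorem summable_phi {N : ℕ} (Z : State N →L[ℝ] State N) :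
    Summable (fun i : ℕ => ((Nat.factorial (i + 1) : ℝ)⁻¹) • Z ^ i) := by
  refine Summable.of_norm_bounded (NormedSpace.norm_expSeries_summable' (𝕂 := ℝ) Z) ?_
  intro i
  rw [norm_smul, norm_smul]
  refine mul_le_mul_of_nonneg_right ?_ (norm_nonneg _)
  rw [norm_inv, norm_inv, Real.norm_natCast, Real.norm_natCast]
  have h0 : (0 : ℝ) < (Nat.factorial i : ℝ) := by exact_mod_cast Nat.factorial_pos i
  refine inv_anti₀ h0 ?_
  exact_mod_cast Nat.factorial_le (Nat.le_succ i)

/-- The defining relation `Z φ(Z) = e^Z - 1`. -/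
theorem mul_phi {N : ℕ} (Z : State N →L[ℝ] State N) :
    Z * phi Z = NormedSpace.exp Z - 1 := by
  have hs := NormedSpace.expSeries_summable' (𝕂 := ℝ) Z
  have he : NormedSpace.exp Z = ∑' n : ℕ, ((Nat.factorial n : ℝ)⁻¹) • Z ^ n := by
    rw [NormedSpace.exp_eq_tsum ℝ]
  rw [he, hs.tsum_eq_zero_add, phi, ← (summable_phi Z).tsum_mul_left]
  have hm : ∀ i : ℕ, Z * ((Nat.factorial (i + 1) : ℝ)⁻¹ • Z ^ i) =
      (Nat.factorial (i + 1) : ℝ)⁻¹ • Z ^ (i + 1) := fun i => by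
    rw [pow_succ']
    ext1 x
    simp
  simp only [hm]
  simp

/-- The Krylov space `K_M = span {f(y), J f(y), …, J^(M-1) f(y)}` at the point `y`,
where `J = f'(y)` is the Jacobian. -/
def krylovSpace {N : ℕ} (f : State N → State N) (y : State N) (M : ℕ) :
    Submodule ℝ (State N) :=
  Submodule.span ℝ (Set.range fun i : Fin M => ((fderiv ℝ f y) ^ (i : ℕ)) (f y))

/-- The Krylov approximation of the Jacobian, `A = V Vᵀ J V Vᵀ`, where `V` has
orthonormal columns spanning the Krylov space; `V Vᵀ` is the orthogonal projection onto
that space (see `projection_eq_sum`), so `A` does not depend on the choice of `V`. -/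
def krylovJacobian {N : ℕ} (f : State N → State N) (y : State N) (M : ℕ) :
    State N →L[ℝ] State N :=
  (krylovSpace f y M).starProjection ∘L fderiv ℝ f y ∘L (krylovSpace f y M).starProjection

/-- For orthonormal `v_1, …, v_m` spanning the Krylov space, the projection in
`krylovJacobian` is `V Vᵀ x = ∑ ⟪v_i, x⟫ v_i`. -/
theorem projection_eq_sum {N m : ℕ} (f : State N → State N) (y : State N) (M : ℕ)
    (v : Fin m → State N) (hv : Orthonormal ℝ v)
    (hspan : Submodule.span ℝ (Set.range v) = krylovSpace f y M) (x : State N) :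
    (krylovSpace f y M).starProjection x = ∑ i, inner ℝ (v i) x • v i := by
  rw [← hspan]
  refine Submodule.eq_starProjection_of_mem_of_inner_eq_zero ?_ ?_
  · exact Submodule.sum_mem _ fun i _ =>
      Submodule.smul_mem _ _ (Submodule.subset_span (Set.mem_range_self i))
  · intro w hw
    induction hw using Submodule.span_induction with
    | mem w hw =>
      obtain ⟨j, rfl⟩ := hw
      rw [inner_sub_left, sum_inner]
      simp only [inner_smul_left, orthonormal_iff_ite.mp hv]
      simp [real_inner_comm]
    | zero => simp
    | add a b _ _ ha hb => rw [inner_add_right, ha, hb, add_zero]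
    | smul c a _ ha => rw [inner_smul_right, ha, mul_zero]

/-- The coefficients of an `s`-stage scheme: the scalar `γ` inside `φ`, the strictly lower
triangular arrays `α_{i,j}` and `γ_{i,j}`, and the weights `b_i`. -/
structure Scheme (s : ℕ) where
  gam : ℝ
  alpha : Matrix (Fin s) (Fin s) ℝ
  gamma : Matrix (Fin s) (Fin s) ℝ
  b : Fin s → ℝ
  alpha_lower : ∀ i j, i ≤ j → alpha i j = 0
  gamma_lower : ∀ i j, i ≤ j → gamma i j = 0

namespace Scheme

variable {s : ℕ}

/-- `β_{i,j} = α_{i,j} + γ_{i,j}`. -/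
def beta (S : Scheme s) : Matrix (Fin s) (Fin s) ℝ := S.alpha + S.gamma

/-- The stages of the scheme with matrix `A` and step size `h` started at `y`:
`k_i = φ(hγA) (h F_i + h A ∑_{j<i} γ_{i,j} k_j)`, `F_i = f (y + ∑_{j<i} α_{i,j} k_j)`. -/
def stage (S : Scheme s) {N : ℕ} (f : State N → State N) (A : State N →L[ℝ] State N)
    (y : State N) (h : ℝ) (i : Fin s) : State N :=
  phi ((h * S.gam) • A)
    (h • f (y + ∑ j : Fin s, if _hj : j < i then S.alpha i j • S.stage f A y h j else 0) +
      h • A (∑ j : Fin s, if _hj : j < i then S.gamma i j • S.stage f A y h j else 0))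
termination_by i

/-- One step of the exponential-K method: the scheme is run with the Krylov
approximation of the Jacobian at `y` built from `M` Krylov vectors. -/
def krylovStep (S : Scheme s) {N : ℕ} (f : State N → State N) (M : ℕ)
    (y : State N) (h : ℝ) : State N :=
  y + ∑ i : Fin s, S.b i • S.stage f (krylovJacobian f y M) y h i

/-- The nine exponential-K order conditions up to order four, `∑_j b_j Φ_j(τ) = P_τ(γ)`,
one for each TK-tree `τ` with at most four vertices. The elementary differential of the
tree is displayed above each condition. -/
structure OrderConditions (S : Scheme s) : Prop where
  /-- `f` -/
  cond_a : ∑ j, S.b j = 1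
  /-- `f' f` -/
  cond_b : ∑ j, ∑ k, S.b j * S.beta j k = 1 / 2 * (1 - S.gam)
  /-- `f''(f, f)` -/
  cond_c : ∑ j, ∑ k, ∑ l, S.b j * (S.alpha j k * S.alpha j l) = 1 / 3
  /-- `f' f' f` -/
  cond_d : ∑ j, ∑ k, ∑ l, S.b j * (S.beta j k * S.beta k l) =
    1 / 3 * (1 / 2 - S.gam) * (1 - S.gam)
  /-- `f'''(f, f, f)` -/
  cond_e : ∑ j, ∑ k, ∑ l, ∑ m, S.b j * (S.alpha j k * S.alpha j l * S.alpha j m) = 1 / 4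
  /-- `f''(f' f, f)` -/
  cond_f : ∑ j, ∑ k, ∑ l, ∑ m, S.b j * (S.alpha j k * S.beta k l * S.alpha j m) =
    1 / 8 - S.gam / 6
  /-- `f' f''(f, f)` -/
  cond_g1 : ∑ j, ∑ k, ∑ l, ∑ m, S.b j * (S.alpha j k * S.alpha k m * S.alpha k l) = 1 / 12
  /-- `A f''(f, f)` -/
  cond_g2 : ∑ j, ∑ k, ∑ l, ∑ m, S.b j * (S.gamma j k * S.alpha k m * S.alpha k l) =
    -(S.gam / 6)
  /-- `f' f' f' f` -/
  cond_h : ∑ j, ∑ k, ∑ l, ∑ m, S.b j * (S.beta j k * S.beta k l * S.beta l m) =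
    1 / 4 * (1 / 3 - S.gam) * (1 / 2 - S.gam) * (1 - S.gam)

/-- The exponential-K method with `M` Krylov vectors has order `p`: for every dimension `N`,
every autonomous system `y' = f(y)` in `ℝ^N` and every solution `y` on an interval
`[tₙ, t_F]` such that `f` is of class `C^p` near `y(tₙ)`, one step started at the exact value
`y(tₙ)` has local error `O(h^(p+1))` as the step size `h` tends to `0` from the right. -/
def HasKrylovOrder (S : Scheme s) (M p : ℕ) : Prop :=
  ∀ (N : ℕ) (f : State N → State N) (tn tF : ℝ) (y : ℝ → State N), tn < tF →
    ContDiffAt ℝ p f (y tn) →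
    (∀ t ∈ Icc tn tF, HasDerivWithinAt y (f (y t)) (Icc tn tF) t) →
    (fun h : ℝ => S.krylovStep f M (y tn) h - y (tn + h)) =O[𝓝[>] 0] fun h => h ^ (p + 1)

end Scheme

/-- The coefficients of the four-stage method expK. -/
def expK : Scheme 4 where
  gam := 1 / 4
  alpha := !![0, 0, 0, 0;
              1, 0, 0, 0;
              41 / 80, -(1 / 80), 0, 0;
              1 / 4, 1 / 12, 1 / 6, 0]
  gamma := !![0, 0, 0, 0;
              7 / 8, 0, 0, 0;
              1 / 16, 0, 0, 0;
              -(1 / 32), 1 / 24, -(5 / 12), 0]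
  b := ![1 / 6, 1 / 6, 0, 2 / 3]
  alpha_lower := by
    intro i j hij
    fin_cases i <;> fin_cases j <;> first | rfl | (exact absurd hij (by decide))
  gamma_lower := by
    intro i j hij
    fin_cases i <;> fin_cases j <;> first | rfl | (exact absurd hij (by decide))

end ExpK

end

noncomputable section

/-! The numerical and the exact increments are both expanded in powers of `h` through `h⁴`, with
elementary differentials of `f` at `y(tₙ)` as coefficients; once the two expansions agree, the local
error is `O(h⁵)`. `hasJet_solution` expands the exact solution and `hasJet_stage` the stages, by
induction on the stage index.

Write `d = f(y)`, `J = f'(y)`, `H = f''(y)`. For `M ≥ 4` the matrix `A` agrees with `J` on `d`, `J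
d` and `J (J d)` (`krylovJacobian_apply_pow`), so `A` may be replaced by `J` there. The only other
vector it meets up to `h⁴` is `H d d`, which need not lie in the Krylov space. Since each `A`
carries a factor `h` and `H d d` first occurs at `h³`, this costs just one extra differential, `A (H
d d)` at order `h⁴`. That leaves nine differentials, and the nine order conditions make their
`b`-weighted coefficients equal to those of the exact solution, with weight zero for `A (H d d)`.
For expK the conditions are rational arithmetic. -/

/-- `u h = h a + h² b + h³ c + h⁴ e + O(h⁵)` as `h → 0` from the right (including `h = 0`). -/
def HasJet {E : Type*} [NormedAddCommGroup E] [NormedSpace ℝ E] (u : ℝ → E) (a b c e : E) : Prop :=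
  (fun h : ℝ => u h - (h • a + h ^ 2 • b + h ^ 3 • c + h ^ 4 • e)) =O[𝓝[≥] 0] fun h => h ^ 5

/-! ### Comparison of powers of `h` near `0⁺`. -/

section Powers

variable {E : Type*} [NormedAddCommGroup E] [NormedSpace ℝ E]

theorem isBigO_pow_pow_nhdsGE {m n : ℕ} (hmn : m ≤ n) :
    (fun h : ℝ => h ^ n) =O[𝓝[≥] 0] fun h => h ^ m := by
  refine (IsBigO.of_bound 1 ?_).mono nhdsWithin_le_nhds
  filter_upwards [Metric.ball_mem_nhds (0 : ℝ) one_pos] with h hh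
  rw [mem_ball_zero_iff] at hh
  rw [norm_pow, norm_pow, one_mul]
  exact pow_le_pow_of_le_one (norm_nonneg _) hh.le hmn

theorem isBigO_pow_smul {m n : ℕ} (hmn : m ≤ n) (v : E) :
    (fun h : ℝ => h ^ n • v) =O[𝓝[≥] 0] fun h => h ^ m := by
  simpa using (isBigO_pow_pow_nhdsGE hmn).smul
    (isBigO_const_const v (one_ne_zero (α := ℝ)) (𝓝[≥] (0 : ℝ)))

theorem Asymptotics.IsBigO.pow_smul {u : ℝ → E} {m : ℕ} (k : ℕ)
    (hu : u =O[𝓝[≥] 0] fun h : ℝ => h ^ m) :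
    (fun h => h ^ k • u h) =O[𝓝[≥] 0] fun h : ℝ => h ^ (k + m) := by
  simpa [pow_add] using (isBigO_refl (fun h : ℝ => h ^ k) (𝓝[≥] 0)).smul hu

end Powers

/-! ### Calculus of fourth-order jets without constant term. -/

namespace HasJet

variable {E F : Type*} [NormedAddCommGroup E] [NormedSpace ℝ E]
  [NormedAddCommGroup F] [NormedSpace ℝ F]
  {u v : ℝ → E} {a b c e a' b' c' e' : E}

theorem add (hu : HasJet u a b c e) (hv : HasJet v a' b' c' e') :
    HasJet (fun h => u h + v h) (a + a') (b + b') (c + c') (e + e') := by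
  refine (IsBigO.add hu hv).congr_left fun h => ?_
  module

theorem const_smul (r : ℝ) (hu : HasJet u a b c e) :
    HasJet (fun h => r • u h) (r • a) (r • b) (r • c) (r • e) := by
  refine (IsBigO.const_smul_left hu r).congr_left fun h => ?_
  simp only [Pi.smul_apply]
  module

theorem zero : HasJet (fun _ => (0 : E)) 0 0 0 0 := by
  simpa [HasJet] using isBigO_zero _ _

theorem sum {ι : Type*} (s : Finset ι) {u : ι → ℝ → E} {a b c e : ι → E}
    (hu : ∀ i ∈ s, HasJet (u i) (a i) (b i) (c i) (e i)) :
    HasJet (fun h => ∑ i ∈ s, u i h) (∑ i ∈ s, a i) (∑ i ∈ s, b i) (∑ i ∈ s, c i)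
      (∑ i ∈ s, e i) := by
  classical
  induction s using Finset.induction_on with
  | empty => simpa using zero
  | insert i s hi ih =>
    simp only [Finset.sum_insert hi]
    exact (hu i (Finset.mem_insert_self i s)).add
      (ih fun j hj => hu j (Finset.mem_insert_of_mem hj))

theorem isBigO_sub (hu : HasJet u a b c e) (hv : HasJet v a b c e) :
    (fun h => u h - v h) =O[𝓝[≥] 0] fun h : ℝ => h ^ 5 := by
  refine (IsBigO.sub hu hv).congr_left fun h => ?_
  abel

theorem add_isBigO (hu : HasJet u a b c e) (hv : v =O[𝓝[≥] 0] fun h : ℝ => h ^ 5) :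
    HasJet (fun h => u h + v h) a b c e := by
  refine (IsBigO.add hu hv).congr_left fun h => ?_
  module

theorem congr (hu : HasJet u a b c e) (huv : ∀ h, u h = v h) : HasJet v a b c e :=
  IsBigO.congr_left hu fun h => by rw [huv]

theorem isBigO_sub_cubic (hu : HasJet u a b c e) :
    (fun h => u h - (h • a + h ^ 2 • b + h ^ 3 • c)) =O[𝓝[≥] 0] fun h : ℝ => h ^ 4 := by
  refine ((hu.trans (isBigO_pow_pow_nhdsGE (by norm_num))).add
    (isBigO_pow_smul le_rfl e)).congr_left fun h => ?_
  module

theorem isBigO_sub_quadratic (hu : HasJet u a b c e) :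
    (fun h => u h - (h • a + h ^ 2 • b)) =O[𝓝[≥] 0] fun h : ℝ => h ^ 3 := by
  refine ((hu.isBigO_sub_cubic.trans (isBigO_pow_pow_nhdsGE (by norm_num))).add
    (isBigO_pow_smul le_rfl c)).congr_left fun h => ?_
  module

theorem isBigO_sub_linear (hu : HasJet u a b c e) :
    (fun h => u h - h • a) =O[𝓝[≥] 0] fun h : ℝ => h ^ 2 := by
  refine ((hu.isBigO_sub_quadratic.trans (isBigO_pow_pow_nhdsGE (by norm_num))).add
    (isBigO_pow_smul le_rfl b)).congr_left fun h => ?_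
  module

theorem isBigO (hu : HasJet u a b c e) : u =O[𝓝[≥] 0] fun h : ℝ => h ^ 1 := by
  refine ((hu.isBigO_sub_linear.trans (isBigO_pow_pow_nhdsGE (by norm_num))).add
    (isBigO_pow_smul le_rfl a)).congr_left fun h => ?_
  module

theorem tendsto (hu : HasJet u a b c e) : Tendsto u (𝓝[≥] 0) (𝓝 0) := by
  refine hu.isBigO.trans_tendsto ?_
  simpa [pow_one, Function.id_def] using (tendsto_id (x := 𝓝 (0 : ℝ))).mono_left nhdsWithin_le_nhds

/-- Jets under multiplication by `h` and a linear map. -/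
theorem smul_map (hu : HasJet u a b c e) (A : E →L[ℝ] F) :
    HasJet (fun h => h • A (u h)) 0 (A a) (A b) (A c) := by
  refine (IsBigO.pow_smul 1 ((A.isBigO_comp _ _).trans hu.isBigO_sub_cubic)).congr_left
    fun h => ?_
  simp only [map_sub, map_add, map_smul]
  module

theorem polynomial (a b c e : E) :
    HasJet (fun h : ℝ => h • a + h ^ 2 • b + h ^ 3 • c + h ^ 4 • e) a b c e := by
  simpa [HasJet] using isBigO_zero _ _

end HasJet

/-! ### Taylor expansion of `f` along a jet. -/

section Taylor

variable {E F : Type*} [NormedAddCommGroup E] [NormedSpace ℝ E]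
  [NormedAddCommGroup F] [NormedSpace ℝ F]

/-- Changing the argument of an `n`-linear map costs at most `n ‖T‖ max(‖u‖, ‖v‖)^(n-1) ‖u - v‖`.
With `u, v = O(h)`, the factor `h^(n-1)` comes for free, so the higher derivatives of `f` only need
short truncations of the jet. -/
theorem ContinuousMultilinearMap.isBigO_sub_diag {n m k : ℕ} [NeZero n]
    (T : ContinuousMultilinearMap ℝ (fun _ : Fin n => E) F) {u v : ℝ → E}
    (hu : u =O[𝓝[≥] 0] fun h : ℝ => h ^ 1) (hv : v =O[𝓝[≥] 0] fun h : ℝ => h ^ 1)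
    (huv : (fun h => u h - v h) =O[𝓝[≥] 0] fun h : ℝ => h ^ m) (hk : k = n - 1 + m) :
    (fun h => T (fun _ => u h) - T (fun _ => v h)) =O[𝓝[≥] 0] fun h : ℝ => h ^ k := by
  have hn : (Finset.univ : Finset (Fin n)).Nonempty := Finset.univ_nonempty
  have hmax : (fun h => max ‖u h‖ ‖v h‖) =O[𝓝[≥] 0] fun h : ℝ => h := by
    refine IsBigO.trans (IsBigO.of_norm_le fun h => ?_)
      ((hu.norm_left.add hv.norm_left).congr_right fun h => pow_one h)
    rw [Real.norm_of_nonneg (le_max_of_le_left (norm_nonneg _))]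
    exact max_le_add_of_nonneg (norm_nonneg _) (norm_nonneg _)
  have key : (fun h => T (fun _ => u h) - T (fun _ => v h)) =O[𝓝[≥] 0]
      fun h => max ‖u h‖ ‖v h‖ ^ (n - 1) * ‖u h - v h‖ := by
    refine IsBigO.of_bound (‖T‖ * n) (Eventually.of_forall fun h => ?_)
    refine (T.norm_image_sub_le _ _).trans_eq ?_
    have : (fun _ : Fin n => u h) - (fun _ => v h) = fun _ => u h - v h := rfl
    rw [this, pi_norm_const, pi_norm_const, pi_norm_const, Fintype.card_fin, Real.norm_of_nonneg]
    · ring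
    · positivity
  rw [hk]
  refine key.trans ?_
  simpa [pow_add] using (hmax.pow (n - 1)).mul huv.norm_left

variable [CompleteSpace F]

/-- Taylor's formula of order three with remainder `O(‖x‖⁴)`. -/
theorem ContDiffAt.isBigO_taylor_three {f : E → F} {y : E} (hf : ContDiffAt ℝ 4 f y) :
    (fun x => f (y + x) - (f y + fderiv ℝ f y x + (1 / 2 : ℝ) • iteratedFDeriv ℝ 2 f y (fun _ => x)
      + (1 / 6 : ℝ) • iteratedFDeriv ℝ 3 f y (fun _ => x))) =O[𝓝 0] fun x => ‖x‖ ^ 4 := by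
  have hev : ∀ᶠ z in 𝓝 y, ContDiffAt ℝ 4 f z := hf.eventually (by decide)
  have hb : ∀ᶠ z in 𝓝 y, ‖iteratedFDeriv ℝ 4 f z‖ ≤ ‖iteratedFDeriv ℝ 4 f y‖ + 1 := by
    -- Continuity of the fourth derivative at `y` bounds it on a ball, which controls the integral
    -- remainder.
    have hc : ContinuousAt (fun z => ‖iteratedFDeriv ℝ 4 f z‖) y :=
      ((hf.iteratedFDeriv_right (i := 4) (m := 0) (by norm_num)).continuousAt).norm
    exact (hc.eventually_lt continuousAt_const (lt_add_one _)).mono fun z hz => hz.le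
  obtain ⟨δ, hδ, hball⟩ := Metric.eventually_nhds_iff_ball.1 (hev.and hb)
  refine IsBigO.of_bound (1 / 6 * (‖iteratedFDeriv ℝ 4 f y‖ + 1)) ?_
  filter_upwards [Metric.ball_mem_nhds (0 : E) hδ] with x hx
  rw [mem_ball_zero_iff] at hx
  have hmem : ∀ t ∈ Icc (0 : ℝ) 1, y + t • x ∈ Metric.ball y δ := fun t ht => by
    rw [mem_ball_iff_norm, add_sub_cancel_left, norm_smul, Real.norm_of_nonneg ht.1]
    exact (mul_le_of_le_one_left (norm_nonneg _) ht.2).trans_lt hx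
  have htay := map_add_eq_sum_add_integral_iteratedFDeriv (n := 3) (f := f) (x := y) (y := x)
    fun t ht => by simpa [show (3 : WithTop ℕ∞) + 1 = 4 by norm_num] using (hball _ (hmem t ht)).1
  rw [htay]
  simp only [Finset.sum_range_succ, Finset.sum_range_zero]
  have hint : ‖∫ t in (0 : ℝ)..1, (1 - t) ^ 3 • iteratedFDeriv ℝ (3 + 1) f (y + t • x) fun _ => x‖
      ≤ (‖iteratedFDeriv ℝ 4 f y‖ + 1) * ‖x‖ ^ 4 := by
    refine (intervalIntegral.norm_integral_le_of_norm_le_const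
      (C := (‖iteratedFDeriv ℝ 4 f y‖ + 1) * ‖x‖ ^ 4) fun t ht => ?_).trans_eq (by simp)
    rw [uIoc_of_le zero_le_one] at ht
    rw [norm_smul, norm_pow, Real.norm_of_nonneg (by linarith [ht.2])]
    have h1 : (1 - t) ^ 3 ≤ 1 := pow_le_one₀ (by linarith [ht.2]) (by linarith [ht.1])
    have h2 : ‖iteratedFDeriv ℝ (3 + 1) f (y + t • x) fun _ => x‖
        ≤ (‖iteratedFDeriv ℝ 4 f y‖ + 1) * ‖x‖ ^ 4 := by
      refine (ContinuousMultilinearMap.le_opNorm _ _).trans ?_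
      simp only [Finset.prod_const, Finset.card_univ, Fintype.card_fin]
      gcongr
      exact (hball _ (hmem t ⟨ht.1.le, ht.2⟩)).2
    exact (mul_le_of_le_one_left (norm_nonneg _) h1).trans h2
  rw [Real.norm_of_nonneg (by positivity : (0 : ℝ) ≤ ‖x‖ ^ 4)]
  refine le_trans (le_of_eq ?_) ((mul_le_mul_of_nonneg_left hint
    (by norm_num : (0 : ℝ) ≤ 1 / 6)).trans_eq (by ring))
  rw [← Real.norm_of_nonneg (by norm_num : (0 : ℝ) ≤ 1 / 6), ← norm_smul]
  congr 1
  norm_num [Nat.factorial]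

/-- The expansion of `f (y + u h)` up to `O(h⁴)`. -/
theorem HasJet.isBigO_comp {f : E → F} {y : E} (hf : ContDiffAt ℝ 4 f y) {u : ℝ → E}
    {a b c e : E} (hu : HasJet u a b c e) :
    (fun h => f (y + u h) - (f y + h • fderiv ℝ f y a
      + h ^ 2 • (fderiv ℝ f y b + (1 / 2 : ℝ) • fderiv ℝ (fderiv ℝ f) y a a)
      + h ^ 3 • (fderiv ℝ f y c + fderiv ℝ (fderiv ℝ f) y a b
        + (1 / 6 : ℝ) • iteratedFDeriv ℝ 3 f y (fun _ => a)))) =O[𝓝[≥] 0]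
      fun h : ℝ => h ^ 4 := by
  have h0 := (hf.isBigO_taylor_three.comp_tendsto hu.tendsto).trans
    (by simpa [Function.comp_def] using hu.isBigO.norm_left.pow 4)
  have h1 := ((fderiv ℝ f y).isBigO_comp _ _).trans hu.isBigO_sub_cubic
  have hp1 : (fun h : ℝ => h • a) =O[𝓝[≥] 0] fun h => h ^ 1 := by
    simpa using isBigO_pow_smul (le_refl 1) a
  have hp2 : (fun h : ℝ => h • a + h ^ 2 • b) =O[𝓝[≥] 0] fun h => h ^ 1 :=
    hp1.add (isBigO_pow_smul one_le_two b)
  have h2 := (ContinuousMultilinearMap.isBigO_sub_diag (iteratedFDeriv ℝ 2 f y) hu.isBigO hp2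
    hu.isBigO_sub_quadratic (k := 4) rfl).const_smul_left (1 / 2 : ℝ)
  have h3 := (ContinuousMultilinearMap.isBigO_sub_diag (iteratedFDeriv ℝ 3 f y) hu.isBigO hp1
    hu.isBigO_sub_linear (k := 4) rfl).const_smul_left (1 / 6 : ℝ)
  -- Inserting `h a + h² b` into the quadratic term also produces `h⁴ H b b / 2`, which is absorbed
  -- in the remainder.
  have h4 := isBigO_pow_smul (le_refl 4) ((1 / 2 : ℝ) • fderiv ℝ (fderiv ℝ f) y b b)
  have hsymm : fderiv ℝ (fderiv ℝ f) y b a = fderiv ℝ (fderiv ℝ f) y a b :=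
    (hf.isSymmSndFDerivAt (by simp; norm_num)).eq b a
  refine ((((h0.add h1).add h2).add h3).add h4).congr_left fun h => ?_
  have hT : iteratedFDeriv ℝ 3 f y (fun _ => h • a) =
      h ^ 3 • iteratedFDeriv ℝ 3 f y (fun _ => a) := by
    simpa using (iteratedFDeriv ℝ 3 f y).map_smul_univ (fun _ => h) (fun _ => a)
  simp only [Function.comp_apply, Pi.smul_apply, iteratedFDeriv_two_apply, hT, map_add, map_sub, map_smul,
    add_apply, smul_apply, hsymm]
  module

/-- The outer factor `h` supplies the missing order: the jet of `h f(y + u)` through `h⁴` does not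
involve the coefficient `e` of `u`. -/
theorem HasJet.smul_comp {f : E → F} {y : E} (hf : ContDiffAt ℝ 4 f y) {u : ℝ → E}
    {a b c e : E} (hu : HasJet u a b c e) :
    HasJet (fun h => h • f (y + u h)) (f y) (fderiv ℝ f y a)
      (fderiv ℝ f y b + (1 / 2 : ℝ) • fderiv ℝ (fderiv ℝ f) y a a)
      (fderiv ℝ f y c + fderiv ℝ (fderiv ℝ f) y a b
        + (1 / 6 : ℝ) • iteratedFDeriv ℝ 3 f y (fun _ => a)) := by
  refine (IsBigO.pow_smul 1 (hu.isBigO_comp hf)).congr_left fun h => ?_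
  module

end Taylor

/-! ### Expansion of the exact solution. -/

section ODE

variable {E : Type*} [NormedAddCommGroup E] [NormedSpace ℝ E]

/-- The mean value inequality on `[0, h]` gains one power of `h`. -/
theorem isBigO_pow_succ_of_hasDerivWithinAt {g g' : ℝ → E} {L : ℝ} (hL : 0 < L) (hg0 : g 0 = 0)
    (hd : ∀ t ∈ Icc 0 L, HasDerivWithinAt g (g' t) (Icc 0 L) t) {k : ℕ}
    (hg' : g' =O[𝓝[≥] 0] fun h : ℝ => h ^ k) : g =O[𝓝[≥] 0] fun h : ℝ => h ^ (k + 1) := by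
  obtain ⟨C, hC, hb⟩ := hg'.exists_nonneg
  obtain ⟨δ, hδ, hsub⟩ := mem_nhdsGE_iff_exists_Ico_subset.1 hb.bound
  refine IsBigO.of_bound C ?_
  filter_upwards [Ico_mem_nhdsGE (lt_min hδ hL)] with h hh
  have hhL : h ≤ L := hh.2.le.trans (min_le_right _ _)
  have := norm_image_sub_le_of_norm_deriv_le_segment' (f := g) (f' := g') (a := 0) (b := h)
    (C := C * h ^ k)
    (fun t ht => (hd t ⟨ht.1, ht.2.trans hhL⟩).mono (Icc_subset_Icc_right hhL))
    (fun t ht => by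
      have h1 : ‖g' t‖ ≤ C * ‖t ^ k‖ :=
        hsub ⟨ht.1, (ht.2.trans hh.2).trans_le (min_le_left _ _)⟩
      rw [norm_pow, Real.norm_of_nonneg ht.1] at h1
      exact h1.trans (mul_le_mul_of_nonneg_left (pow_le_pow_left₀ ht.1 ht.2.le _) hC))
    h (right_mem_Icc.2 hh.1)
  rw [hg0, sub_zero, sub_zero] at this
  rw [norm_pow, Real.norm_of_nonneg hh.1, pow_succ, ← mul_assoc]
  exact this

variable [CompleteSpace E]

/-- The Taylor expansion of a solution of `y' = f(y)` in terms of elementary differentials. -/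
theorem hasJet_solution {f : E → E} {tn tF : ℝ} {y : ℝ → E} (htn : tn < tF)
    (hf : ContDiffAt ℝ 4 f (y tn))
    (hy : ∀ t ∈ Icc tn tF, HasDerivWithinAt y (f (y t)) (Icc tn tF) t) {d : E} {J : E →L[ℝ] E}
    {H : E →L[ℝ] E →L[ℝ] E} (hd : f (y tn) = d) (hJ : fderiv ℝ f (y tn) = J)
    (hH : fderiv ℝ (fderiv ℝ f) (y tn) = H) :
    HasJet (fun h => y (tn + h) - y tn) d ((1 / 2 : ℝ) • J d)
      ((1 / 6 : ℝ) • (J (J d) + H d d))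
      ((1 / 24 : ℝ) • (J (J (J d)) + J (H d d) + (3 : ℝ) • H d (J d)
        + iteratedFDeriv ℝ 3 f (y tn) (fun _ => d))) := by
  set e : E := (1 / 24 : ℝ) • (J (J (J d)) + J (H d d) + (3 : ℝ) • H d (J d)
        + iteratedFDeriv ℝ 3 f (y tn) (fun _ => d)) with he
  set p : ℝ → E := fun h => h • d + h ^ 2 • ((1 / 2 : ℝ) • J d)
    + h ^ 3 • ((1 / 6 : ℝ) • (J (J d) + H d d)) + h ^ 4 • e with hp
  set p' : ℝ → E := fun h => d + h • J d + h ^ 2 • ((1 / 2 : ℝ) • (J (J d) + H d d))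
    + h ^ 3 • ((4 : ℝ) • e) with hp'
  have hpj : HasJet p d ((1 / 2 : ℝ) • J d) ((1 / 6 : ℝ) • (J (J d) + H d d)) e :=
    HasJet.polynomial _ _ _ _
  have hpd : ∀ h, HasDerivAt p (p' h) h := by
    intro h
    have := ((((hasDerivAt_id h).smul_const d).add
      ((hasDerivAt_pow 2 h).smul_const ((1 / 2 : ℝ) • J d))).add
      ((hasDerivAt_pow 3 h).smul_const ((1 / 6 : ℝ) • (J (J d) + H d d)))).add
      ((hasDerivAt_pow 4 h).smul_const e)
    refine this.congr_deriv ?_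
    simp only [hp']
    push_cast
    norm_num
    module
  -- The candidate polynomial solves the equation up to a defect `O(h⁴)`.
  have hdefect : (fun h => f (y tn + p h) - p' h) =O[𝓝[≥] 0] fun h : ℝ => h ^ 4 := by
    refine (hpj.isBigO_comp hf).congr_left fun h => ?_
    simp only [hp', he, hd, hJ, hH, map_smul, map_add]
    module
  have hL : 0 < tF - tn := sub_pos.2 htn
  set w : ℝ → E := fun h => y (tn + h) - y tn with hw
  have hwd : ∀ h ∈ Icc 0 (tF - tn), HasDerivWithinAt w (f (y tn + w h)) (Icc 0 (tF - tn)) h := by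
    intro h hh
    have hmaps : MapsTo (fun h => tn + h) (Icc 0 (tF - tn)) (Icc tn tF) := fun x hx =>
      ⟨by linarith [hx.1], by linarith [hx.2]⟩
    have h1 := (hy (tn + h) (hmaps hh)).scomp h
      ((hasDerivAt_id h).const_add tn).hasDerivWithinAt hmaps
    simpa [hw, Function.comp_def] using h1.sub_const (y tn)
  have hw0 : w 0 = 0 := by simp [hw]
  have hwt : Tendsto w (𝓝[≥] 0) (𝓝 0) := by
    have := (hwd 0 ⟨le_rfl, hL.le⟩).continuousWithinAt
    rw [ContinuousWithinAt, hw0, nhdsWithin_Icc_eq_nhdsGE hL] at this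
    exact this
  have hdw : ∀ h ∈ Icc 0 (tF - tn), HasDerivWithinAt (fun h => w h - p h)
      (f (y tn + w h) - p' h) (Icc 0 (tF - tn)) h := fun h hh =>
    (hwd h hh).sub (hpd h).hasDerivWithinAt
  obtain ⟨K, s, hs, hK⟩ := (hf.of_le (by norm_num : (1 : WithTop ℕ∞) ≤ 4)).exists_lipschitzOnWith
  have hlip : (fun h => f (y tn + w h) - f (y tn + p h)) =O[𝓝[≥] 0] fun h => w h - p h := by
    have hin : ∀ {q : ℝ → E}, Tendsto q (𝓝[≥] 0) (𝓝 0) → ∀ᶠ h in 𝓝[≥] 0, y tn + q h ∈ s := by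
      intro q hq
      have : Tendsto (fun h => y tn + q h) (𝓝[≥] 0) (𝓝 (y tn)) := by
        simpa using hq.const_add (y tn)
      exact this hs
    refine IsBigO.of_bound K ?_
    filter_upwards [hin hwt, hin hpj.tendsto] with h h1 h2
    simpa [dist_eq_norm] using hK.dist_le_mul _ h1 _ h2
  -- By the Lipschitz bound the derivative of `w - p` is `O(w - p) + O(h⁴)`, so each integration
  -- raises the known order by one, from `O(1)` up to `O(h⁵)`.
  have hboot : ∀ k ≤ 5, (fun h => w h - p h) =O[𝓝[≥] 0] fun h : ℝ => h ^ k := by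
    intro k
    induction k with
    | zero =>
      intro _
      simpa using (hwt.sub hpj.tendsto).isBigO_one ℝ
    | succ k ih =>
      intro hk
      refine isBigO_pow_succ_of_hasDerivWithinAt hL (by simp [hw0, hp]) hdw ?_
      refine ((hlip.trans (ih (by omega))).add
        (hdefect.trans (isBigO_pow_pow_nhdsGE (by omega)))).congr_left fun h => ?_
      abel
  exact hboot 5 le_rfl

end ODE

/-! ### Expansion of `φ(hγA)`. -/

namespace ExpK

variable {N : ℕ}

/-- For `‖Z‖ < 1` the tail of the series is dominated termwise by `‖Z‖⁴ / i!`. -/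
theorem phi_sub_isBigO :
    (fun Z : State N →L[ℝ] State N => phi Z - (1 + (1 / 2 : ℝ) • Z + (1 / 6 : ℝ) • Z ^ 2
      + (1 / 24 : ℝ) • Z ^ 3)) =O[𝓝 0] fun Z => ‖Z‖ ^ 4 := by
  refine IsBigO.of_bound (∑' i : ℕ, (1 : ℝ) / (Nat.factorial i : ℝ)) ?_
  filter_upwards [Metric.ball_mem_nhds (0 : State N →L[ℝ] State N) one_pos] with Z hZ
  rw [mem_ball_zero_iff] at hZ
  have hsum := (summable_phi Z).sum_add_tsum_nat_add 4
  have hrem : phi Z - (1 + (1 / 2 : ℝ) • Z + (1 / 6 : ℝ) • Z ^ 2 + (1 / 24 : ℝ) • Z ^ 3) =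
      ∑' i : ℕ, ((Nat.factorial (i + 4 + 1) : ℝ)⁻¹) • Z ^ (i + 4) := by
    rw [phi, ← hsum]
    simp only [Finset.sum_range_succ, Finset.sum_range_zero]
    norm_num [Nat.factorial]
  have hexp : HasSum (fun i : ℕ => (1 : ℝ) / (Nat.factorial i : ℝ))
      (∑' i : ℕ, (1 : ℝ) / (Nat.factorial i : ℝ)) := by
    simpa using (Real.summable_pow_div_factorial 1).hasSum
  rw [hrem, Real.norm_of_nonneg (by positivity : 0 ≤ ‖Z‖ ^ 4)]
  refine tsum_of_norm_bounded (hexp.mul_right (‖Z‖ ^ 4)) fun i => ?_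
  rw [norm_smul, norm_inv, Real.norm_natCast, one_div]
  refine mul_le_mul ?_ ?_ (norm_nonneg _) (by positivity)
  · refine inv_anti₀ (by exact_mod_cast Nat.factorial_pos i) ?_
    exact_mod_cast Nat.factorial_le (by omega)
  · exact (norm_pow_le' Z (by omega)).trans
      (pow_le_pow_of_le_one (norm_nonneg _) hZ.le (by omega))

end ExpK

/-- Each factor `h A` shifts the jet by one place. As `v = O(h)`, the cubic truncation of `φ` leaves
an error `O(h⁵)`. -/
theorem HasJet.phi_apply {N : ℕ} {v : ℝ → ExpK.State N} {a b c e : ExpK.State N}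
    (hv : HasJet v a b c e) (A : ExpK.State N →L[ℝ] ExpK.State N) (g : ℝ) :
    HasJet (fun h => ExpK.phi ((h * g) • A) (v h)) a (b + (g / 2) • A a)
      (c + (g / 2) • A b + (g ^ 2 / 6) • A (A a))
      (e + (g / 2) • A c + (g ^ 2 / 6) • A (A b) + (g ^ 3 / 24) • A (A (A a))) := by
  have hZ : Tendsto (fun h : ℝ => (h * g) • A) (𝓝[≥] 0) (𝓝 0) := by
    have : Continuous fun h : ℝ => (h * g) • A := by fun_prop
    exact (this.tendsto' 0 0 (by rw [zero_mul]; exact zero_smul ℝ A)).mono_left nhdsWithin_le_nhds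
  have hZ4 : (fun h : ℝ => ‖(h * g) • A‖ ^ 4) =O[𝓝[≥] 0] fun h => h ^ 4 := by
    refine IsBigO.of_bound (‖g‖ ^ 4 * ‖A‖ ^ 4) (Eventually.of_forall fun h => ?_)
    rw [norm_pow, norm_norm, norm_smul, norm_mul, norm_pow]
    exact le_of_eq (by ring)
  have hrem : (fun h => (ExpK.phi ((h * g) • A) - (1 + (1 / 2 : ℝ) • ((h * g) • A)
      + (1 / 6 : ℝ) • ((h * g) • A) ^ 2 + (1 / 24 : ℝ) • ((h * g) • A) ^ 3) :
      ExpK.State N →L[ℝ] ExpK.State N) (v h))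
      =O[𝓝[≥] 0] fun h : ℝ => h ^ 5 := by
    have h5 := (((ExpK.phi_sub_isBigO (N := N)).comp_tendsto hZ).trans hZ4).norm_left.mul
      hv.isBigO.norm_left
    simp only [← pow_add] at h5
    refine (IsBigO.of_bound 1 (Eventually.of_forall fun h => ?_)).trans h5
    rw [one_mul, norm_mul, norm_norm, norm_norm]
    exact ContinuousLinearMap.le_opNorm _ _
  have h1 := hv.smul_map A
  have h2 := h1.smul_map A
  have h3 := h2.smul_map A
  have hmain := ((hv.add (h1.const_smul (g / 2))).add (h2.const_smul (g ^ 2 / 6))).add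
    (h3.const_smul (g ^ 3 / 24))
  have key := (hmain.add_isBigO hrem).congr
    (v := fun h => ExpK.phi ((h * g) • A) (v h)) fun h => by
      simp only [sub_apply, add_apply, smul_apply, pow_succ, pow_zero, one_mul, map_smul,
        mul_apply_eq_comp, one_apply_eq_self]
      module
  simpa using key

/-! ### Krylov vectors, stage expansions and order conditions. -/

namespace ExpK

/-- Both `J^k f` and `J^(k+1) f` lie in the Krylov space when `k + 1 < M`, so both projections act
as the identity. -/
theorem krylovJacobian_apply_pow {N : ℕ} (f : State N → State N) (y : State N) {M k : ℕ}
    (hk : k + 1 < M) :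
    krylovJacobian f y M ((fderiv ℝ f y ^ k) (f y)) = (fderiv ℝ f y ^ (k + 1)) (f y) := by
  have hmem : ∀ i < M, (krylovSpace f y M).starProjection ((fderiv ℝ f y ^ i) (f y)) =
      (fderiv ℝ f y ^ i) (f y) := fun i hi =>
    Submodule.starProjection_eq_self_iff.2 (Submodule.subset_span ⟨⟨i, hi⟩, rfl⟩)
  have hs : fderiv ℝ f y ((fderiv ℝ f y ^ k) (f y)) = (fderiv ℝ f y ^ (k + 1)) (f y) := by
    rw [pow_succ', mul_apply_eq_comp]
  rw [krylovJacobian, ContinuousLinearMap.comp_apply, ContinuousLinearMap.comp_apply,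
    hmem k (by omega), hs, hmem (k + 1) hk]

namespace Scheme

variable {s : ℕ} (S : Scheme s)

/-- The row sums of `α`. -/
def alphaSum (i : Fin s) : ℝ := ∑ j, S.alpha i j

/-- The row sums of `β`. -/
def betaSum (i : Fin s) : ℝ := ∑ j, S.beta i j

/-- The coefficient of `f' f` in the `i`-th stage. -/
def coeffB (i : Fin s) : ℝ := S.betaSum i + S.gam / 2

/-- The coefficient of `f' f' f` in the `i`-th stage. -/
def coeffD (i : Fin s) : ℝ :=
  ∑ j, S.beta i j * S.coeffB j + S.gam / 2 * S.betaSum i + S.gam ^ 2 / 6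

/-- The coefficient of `f''(f, f)` in the `i`-th stage. -/
def coeffC (i : Fin s) : ℝ := S.alphaSum i ^ 2 / 2

/-- The coefficient of `f' f' f' f` in the `i`-th stage. -/
def coeffH (i : Fin s) : ℝ :=
  ∑ j, S.beta i j * S.coeffD j + S.gam / 2 * (∑ j, S.beta i j * S.coeffB j)
    + S.gam ^ 2 / 6 * S.betaSum i + S.gam ^ 3 / 24

/-- The coefficient of `f' f''(f, f)` in the `i`-th stage. -/
def coeffG1 (i : Fin s) : ℝ := ∑ j, S.alpha i j * S.coeffC j

/-- The coefficient of `A f''(f, f)` in the `i`-th stage. -/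
def coeffG2 (i : Fin s) : ℝ := ∑ j, S.gamma i j * S.coeffC j + S.gam / 2 * S.coeffC i

/-- The coefficient of `f''(f, f' f)` in the `i`-th stage. -/
def coeffF (i : Fin s) : ℝ := S.alphaSum i * ∑ j, S.alpha i j * S.coeffB j

/-- The coefficient of `f'''(f, f, f)` in the `i`-th stage. -/
def coeffE (i : Fin s) : ℝ := S.alphaSum i ^ 3 / 6

theorem sum_alpha (i : Fin s) : ∑ j, S.alpha i j = S.alphaSum i := rfl

theorem sum_beta (i : Fin s) : ∑ j, S.beta i j = S.betaSum i := rfl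

/-- Only earlier stages need known jets; the vanishing entries of `w` on and above the diagonal turn
the coefficients into full row sums. -/
theorem hasJet_lower_sum {N : ℕ} {k : Fin s → ℝ → State N} {a b c e : Fin s → State N} {i : Fin s}
    {w : Matrix (Fin s) (Fin s) ℝ} (hw : ∀ i j, i ≤ j → w i j = 0)
    (hk : ∀ j < i, HasJet (k j) (a j) (b j) (c j) (e j)) :
    HasJet (fun h => ∑ j : Fin s, if _hj : j < i then w i j • k j h else 0)
      (∑ j, w i j • a j) (∑ j, w i j • b j) (∑ j, w i j • c j) (∑ j, w i j • e j) := by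
  refine HasJet.sum _ fun j _ => ?_
  by_cases hj : j < i
  · simpa only [hj, dite_true] using (hk j hj).const_smul (w i j)
  · simpa only [hj, dite_false, hw i j (not_lt.1 hj), zero_smul] using HasJet.zero

/-- The expansion of the stages in elementary differentials. -/
theorem hasJet_stage {N : ℕ} {f : State N → State N} {y : State N} (hf : ContDiffAt ℝ 4 f y)
    {A J : State N →L[ℝ] State N} {H : State N →L[ℝ] State N →L[ℝ] State N} {d : State N}
    (hd : f y = d) (hJ : fderiv ℝ f y = J) (hH : fderiv ℝ (fderiv ℝ f) y = H)
    (hA0 : A d = J d) (hA1 : A (J d) = J (J d)) (hA2 : A (J (J d)) = J (J (J d))) (i : Fin s) :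
    HasJet (fun h => S.stage f A y h i) d (S.coeffB i • J d)
      (S.coeffD i • J (J d) + S.coeffC i • H d d)
      (S.coeffH i • J (J (J d)) + S.coeffG1 i • J (H d d) + S.coeffG2 i • A (H d d)
        + S.coeffF i • H d (J d) + S.coeffE i • iteratedFDeriv ℝ 3 f y (fun _ => d)) := by
  induction i using WellFoundedLT.induction with
  | ind i ih =>
    have hU := (hasJet_lower_sum S.alpha_lower ih).smul_comp hf
    have hG := (hasJet_lower_sum S.gamma_lower ih).smul_map A
    have hk : HasJet (fun h => S.stage f A y h i) _ _ _ _ :=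
      ((hU.add hG).phi_apply A S.gam).congr fun h => by rw [stage]
    have hT : ∀ r : ℝ, iteratedFDeriv ℝ 3 f y (fun _ => r • d) =
        r ^ 3 • iteratedFDeriv ℝ 3 f y (fun _ => d) := fun r => by
      simpa using (iteratedFDeriv ℝ 3 f y).map_smul_univ (fun _ => r) (fun _ => d)
    have hlin : ∀ (w : Fin s → ℝ) (q : Fin s → ℝ) (x : State N),
        ∑ j, w j • q j • x = (∑ j, w j * q j) • x := fun w q x => by
      simp only [smul_smul, Finset.sum_smul]
    -- `α` comes with `J` (from `f`) and `γ` with `A`; where `A` and `J` agree they merge into `β`,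
    -- while on `H d d` they stay apart as `coeffG1` and `coeffG2`.
    have hβ : ∀ q : Fin s → ℝ, ∑ j, S.beta i j * q j =
        ∑ j, S.alpha i j * q j + ∑ j, S.gamma i j * q j := fun q => by
      simp only [beta, Matrix.add_apply, add_mul, Finset.sum_add_distrib]
    have hβ1 : S.betaSum i = S.alphaSum i + ∑ j, S.gamma i j := by
      simp only [betaSum, alphaSum, beta, Matrix.add_apply, Finset.sum_add_distrib]
    simp only [smul_add, Finset.sum_add_distrib, hlin, ← Finset.sum_smul, hd, hJ, hH] at hk
    simp only [sum_alpha, map_add, map_smul, add_zero, smul_apply, hT, hA0, hA1, hA2] at hk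
    convert hk using 1
    · simp only [coeffB, hβ1]
      module
    · simp only [coeffD, coeffC, hβ, hβ1]
      module
    · simp only [coeffH, coeffG1, coeffG2, coeffF, coeffE, hβ, hβ1]
      simp only [coeffC]
      module

/-- The order conditions imply order four, as soon as at least four Krylov vectors are used. -/
theorem OrderConditions.hasKrylovOrder {S : Scheme s} (hS : S.OrderConditions) {M : ℕ}
    (hM : 4 ≤ M) : S.HasKrylovOrder M 4 := by
  intro N f tn tF y htn hf hy
  set A := krylovJacobian f (y tn) M with hA
  set J := fderiv ℝ f (y tn) with hJ
  set H := fderiv ℝ (fderiv ℝ f) (y tn) with hH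
  set d := f (y tn) with hd
  have hA0 : A d = J d := by
    simpa [pow_succ] using krylovJacobian_apply_pow f (y tn) (M := M) (k := 0) (by omega)
  have hA1 : A (J d) = J (J d) := by
    simpa [pow_succ] using krylovJacobian_apply_pow f (y tn) (M := M) (k := 1) (by omega)
  have hA2 : A (J (J d)) = J (J (J d)) := by
    simpa [pow_succ] using krylovJacobian_apply_pow f (y tn) (M := M) (k := 2) (by omega)
  have hsol := hasJet_solution htn hf hy hd.symm hJ.symm hH.symm
  have hnum := HasJet.sum Finset.univ fun i _ =>
    (S.hasJet_stage hf hd.symm hJ.symm hH.symm hA0 hA1 hA2 i).const_smul (S.b i)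
  have ha := hS.cond_a
  have hb := hS.cond_b
  have hc := hS.cond_c
  have hd' := hS.cond_d
  have he := hS.cond_e
  have hf' := hS.cond_f
  have hg1 := hS.cond_g1
  have hg2 := hS.cond_g2
  have hh := hS.cond_h
  -- The multi-index sums factor into nested row sums, the form in which the stage coefficients are
  -- stated.
  simp only [← Finset.mul_sum, ← Finset.sum_mul, sum_alpha, sum_beta] at hb hc hd' he hf' hg1 hg2 hh
  simp only [mul_assoc, ← Finset.mul_sum] at hh hg1 hg2
  have hB : ∑ i, S.b i * S.coeffB i = 1 / 2 := by
    simp only [coeffB, mul_add, Finset.sum_add_distrib, ← Finset.sum_mul, hb, ha]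
    ring
  have hC : ∑ i, S.b i * S.coeffC i = 1 / 6 := by
    have : ∑ i, S.b i * S.coeffC i = (∑ i, S.b i * (S.alphaSum i * S.alphaSum i)) * (1 / 2) := by
      rw [Finset.sum_mul]
      exact Finset.sum_congr rfl fun i _ => by rw [coeffC]; ring
    rw [this, hc]
    norm_num
  have hE : ∑ i, S.b i * S.coeffE i = 1 / 24 := by
    have : ∑ i, S.b i * S.coeffE i =
        (∑ i, S.b i * (S.alphaSum i * S.alphaSum i * S.alphaSum i)) * (1 / 6) := by
      rw [Finset.sum_mul]
      exact Finset.sum_congr rfl fun i _ => by rw [coeffE]; ring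
    rw [this, he]
    norm_num
  have hβB : ∀ i, ∑ j, S.beta i j * S.coeffB j =
      ∑ j, S.beta i j * S.betaSum j + S.betaSum i * (S.gam / 2) := fun i => by
    simp only [coeffB, mul_add, Finset.sum_add_distrib, ← Finset.sum_mul]
    rfl
  have hD : ∑ i, S.b i * S.coeffD i = 1 / 6 := by
    have : ∑ i, S.b i * S.coeffD i = ∑ i, S.b i * ∑ j, S.beta i j * S.betaSum j
        + (∑ i, S.b i * S.betaSum i) * S.gam + (∑ i, S.b i) * (S.gam ^ 2 / 6) := by
      simp only [Finset.sum_mul, ← Finset.sum_add_distrib]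
      exact Finset.sum_congr rfl fun i _ => by rw [coeffD, hβB]; ring
    rw [this, hd', hb, ha]
    ring
  have hβD : ∀ i, ∑ j, S.beta i j * S.coeffD j =
      ∑ j, S.beta i j * ∑ k, S.beta j k * S.betaSum k
        + (∑ j, S.beta i j * S.betaSum j) * S.gam + S.betaSum i * (S.gam ^ 2 / 6) := fun i => by
    simp only [betaSum, Finset.sum_mul, ← Finset.sum_add_distrib]
    refine Finset.sum_congr rfl fun j _ => ?_
    rw [coeffD, hβB]
    simp only [betaSum]
    ring
  have hHH : ∑ i, S.b i * S.coeffH i = 1 / 24 := by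
    -- The constants collect the `φ` contributions: `1 + 1/2 = 3/2` and `1/6 + 1/4 + 1/6 = 7/12`.
    have : ∑ i, S.b i * S.coeffH i =
        ∑ i, S.b i * ∑ j, S.beta i j * ∑ k, S.beta j k * S.betaSum k
        + (∑ i, S.b i * ∑ j, S.beta i j * S.betaSum j) * (S.gam * 3 / 2)
        + (∑ i, S.b i * S.betaSum i) * (S.gam ^ 2 * 7 / 12)
        + (∑ i, S.b i) * (S.gam ^ 3 / 24) := by
      simp only [Finset.sum_mul _ _ (_ : ℝ), ← Finset.sum_add_distrib]
      exact Finset.sum_congr rfl fun i _ => by rw [coeffH, hβB, hβD]; ring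
    rw [this, hh, hd', hb, ha]
    ring
  have hG1 : ∑ i, S.b i * S.coeffG1 i = 1 / 24 := by
    have : ∑ i, S.b i * S.coeffG1 i =
        (∑ i, S.b i * ∑ j, S.alpha i j * (S.alphaSum j * S.alphaSum j)) * (1 / 2) := by
      simp only [coeffG1, coeffC, Finset.sum_mul, Finset.mul_sum]
      exact Finset.sum_congr rfl fun i _ => Finset.sum_congr rfl fun j _ => by ring
    rw [this, hg1]
    norm_num
  -- `A (H d d)` is absent from the exact solution: `-γ/12` from the order condition cancels
  -- `(γ/2)(1/6)` from `φ`.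
  have hG2 : ∑ i, S.b i * S.coeffG2 i = 0 := by
    have : ∑ i, S.b i * S.coeffG2 i =
        (∑ i, S.b i * ∑ j, S.gamma i j * (S.alphaSum j * S.alphaSum j)) * (1 / 2)
        + (∑ i, S.b i * S.coeffC i) * (S.gam / 2) := by
      simp only [coeffG2, mul_add, Finset.sum_add_distrib, Finset.sum_mul, Finset.mul_sum]
      congr 1
      · exact Finset.sum_congr rfl fun i _ => Finset.sum_congr rfl fun j _ => by
          rw [coeffC]; ring
      · exact Finset.sum_congr rfl fun i _ => by ring
    rw [this, hg2, hC]
    ring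
  have hF : ∑ i, S.b i * S.coeffF i = 1 / 8 := by
    have : ∑ i, S.b i * S.coeffF i =
        ∑ i, S.b i * ((∑ j, S.alpha i j * S.betaSum j) * S.alphaSum i)
        + (∑ i, S.b i * (S.alphaSum i * S.alphaSum i)) * (S.gam / 2) := by
      rw [Finset.sum_mul, ← Finset.sum_add_distrib]
      refine Finset.sum_congr rfl fun i _ => ?_
      simp only [coeffF, coeffB, mul_add, Finset.sum_add_distrib, ← Finset.sum_mul]
      rw [sum_alpha]
      ring
    rw [this, hf', hc]
    ring
  simp only [smul_add, smul_smul, Finset.sum_add_distrib, ← Finset.sum_smul, ha, hB, hC, hD, hE,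
    hHH, hG1, hG2, hF] at hnum
  have hnum' : HasJet (fun h => ∑ i, S.b i • S.stage f A (y tn) h i) d ((1 / 2 : ℝ) • J d)
      ((1 / 6 : ℝ) • (J (J d) + H d d))
      ((1 / 24 : ℝ) • (J (J (J d)) + J (H d d) + (3 : ℝ) • H d (J d)
        + iteratedFDeriv ℝ 3 f (y tn) (fun _ => d))) := by
    convert hnum using 1 <;> module
  -- Jets include `h = 0` because the integration argument starts there; the order statement needs
  -- only `h > 0`.
  refine ((hnum'.isBigO_sub hsol).mono (nhdsWithin_mono _ Ioi_subset_Ici_self)).congr_left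
    fun h => ?_
  rw [krylovStep]
  abel

end Scheme

theorem expK_orderConditions : expK.OrderConditions := by
  constructor <;> simp [expK, Scheme.beta, Fin.sum_univ_four] <;> norm_num

end ExpK

end

theorem mainTheorem4 :
    ExpK.expK.OrderConditions ∧ ∀ M : ℕ, 4 ≤ M → ExpK.expK.HasKrylovOrder M 4 :=
  ⟨ExpK.expK_orderConditions, fun _ hM => ExpK.expK_orderConditions.hasKrylovOrder hM⟩
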